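/- Let $G=(V,E)$ be a simple graph with edge couplings $\kappa_e,\lambda_e,\alpha_e\in\mathbb R$ such that, for every edge $e$, $$\kappa_e\ge 0,\qquad \lambda_e\ge\alpha_e\ge 0,\qquad \alpha_e\le \kappa_e/2 .$$ If $G$ is finite, consider Ising spins $\tau\in\{\pm1\}^V$ and phases $\theta\in(\mathbb R/2\pi\mathbb Z)^V$ with the Hamiltonian $$H_{\lambda,\alpha}(\theta,\tau)=-\sum_{e=ij\in E}\Big[\kappa_e(1+\tau_i\tau_j)\cos(\theta_i-\theta_j)+\lambda_e\tau_i\tau_j+\alpha_e\cos 2(\theta_i-\theta_j)\Big],$$ and write $$\langle f\rangle_{G,\beta}=\frac{\sum_\tau\int d\theta\, f(\theta,\tau)\,e^{-\beta H_{\lambda,\alpha}(\theta,\tau)}}{\sum_\tau\int d\theta\, e^{-\beta H_{\lambda,\alpha}(\theta,\tau)}},$$ where $d\theta$ is the product of the uniform measures on the circles. Then for every $\beta\ge 0$ and all sites $0,R\in V$, $$\langle\cos 2(\theta_0-\theta_R)\rangle_{G,\beta}\le 2\,\langle\tau_0\tau_R\rangle_{G,\beta}.$$ Consequently there is no floating phase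 on any lattice. Namely, let $G$ be arbitrary, possibly infinite, with couplings as above. For $\beta\ge 0$ let $\langle\tau_0\tau_R\rangle_\beta$ and $\langle\cos 2(\theta_0-\theta_R)\rangle_\beta$ be the limits of the corresponding averages in the finite induced subgraphs $G[\Lambda]$ (free boundary conditions) as the finite sets $\Lambda\subset V$ exhaust $V$; formally the upper limits over the finite sets $\Lambda$ directed by inclusion, which are the limits whenever these exist. Fix a site $0$. At temperature $T=1/\beta>0$, call the Ising (respectively XY) spins disordered if there are $C\in\mathbb R$ and $c>0$ such that for all $R\in V$ the absolute value of $\langle\tau_0\tau_R\rangle_\beta$ (respectively $\langle\cos 2(\theta_0-\theta_R)\rangle_\beta$) is at most $Ce^{-c\,d_G(0,R)}$, where $d_G$ is the graph distance (set to $0$ for sites in different components). Let $T_{\mathrm{TRSB}}\in[0,\infty]$ (respectively $T_c\in[0,\infty]$) be the infimum of all $t\in[0,\infty]$ such that the Ising (respectively XY) spins are disordered at every temperature $T\in(0,\infty)$ with $T>t$. Then: 1. $\langle\cos 2(\theta_0-\theta_R)\rangle_\beta\le 2\langle\tau_0\tau_R\rangle_\beta$ for all $\beta\ge 0$ and all $0,R\in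 V$; 2. at every temperature $T>0$ at which the Ising spins are disordered, the XY spins are disordered as well; 3. $T_{\mathrm{TRSB}}\ge T_c$. -/

import Mathlib

open scoped ENNReal

noncomputable section

namespace U1Z2

/-- The circle `ℝ / 2πℤ` in which the phases `θ_i` of the XY spins take values. -/
abbrev Phase : Type := AddCircle (2 * Real.pi)

instance factTwoPiPos : Fact (0 < 2 * Real.pi) := ⟨Real.two_pi_pos⟩

/-- The cosine, as a function on the circle `ℝ / 2πℤ`. -/
def cos (φ : Phase) : ℝ := Real.Angle.cos φ

theorem cos_coe (x : ℝ) : cos (x : Phase) = Real.cos x := Real.Angle.cos_coe x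

theorem cos_neg (φ : Phase) : cos (-φ) = cos φ := Real.Angle.cos_neg φ

/-- Edge couplings `κ_e`, `λ_e`, `α_e` (only their values on edges of the graph are used). -/
structure Couplings (V : Type*) where
  kap : Sym2 V → ℝ
  lam : Sym2 V → ℝ
  alp : Sym2 V → ℝ

/-- The restriction of the couplings to a set of sites. -/
def Couplings.restrict {V : Type*} (J : Couplings V) (S : Set V) : Couplings S where
  kap e := J.kap (e.map Subtype.val)
  lam e := J.lam (e.map Subtype.val)
  alp e := J.alp (e.map Subtype.val)

/-- `τ_i τ_j` for the edge `e = ij`, where the Ising spins are `τ_i = ±1`. -/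
def isingBond {V : Type*} (τ : V → ℤˣ) : Sym2 V → ℝ :=
  Sym2.lift ⟨fun i j => ((τ i : ℤ) : ℝ) * ((τ j : ℤ) : ℝ), fun _ _ => mul_comm _ _⟩

/-- `cos (m ∇_e θ) = cos (m (θ_i - θ_j))` for the edge `e = ij`. -/
def xyBond {V : Type*} (m : ℕ) (θ : V → Phase) : Sym2 V → ℝ :=
  Sym2.lift ⟨fun i j => cos (m • (θ i - θ j)), fun i j => by
    change cos (m • (θ i - θ j)) = cos (m • (θ j - θ i))
    rw [← cos_neg, ← smul_neg, neg_sub]⟩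

section FiniteGraph

variable {V : Type*} [Fintype V]

open Classical in
/-- The critical Hamiltonian `H = -∑_{e = ij} κ_e (1 + τ_i τ_j) cos ∇_e θ` on a finite graph. -/
def criticalHamiltonian (G : SimpleGraph V) (J : Couplings V)
    (θ : V → Phase) (τ : V → ℤˣ) : ℝ :=
  -∑ e ∈ G.edgeFinset, J.kap e * (1 + isingBond τ e) * xyBond 1 θ e

open Classical in
/-- The general Hamiltonian `H_{λ,α} = H - ∑_{e = ij} [λ_e τ_i τ_j + α_e cos (2 ∇_e θ)]`
on a finite graph. -/
def hamiltonian (G : SimpleGraph V) (J : Couplings V) (θ : V → Phase) (τ : V → ℤˣ) : ℝ :=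
  criticalHamiltonian G J θ τ
    - ∑ e ∈ G.edgeFinset, (J.lam e * isingBond τ e + J.alp e * xyBond 2 θ e)

/-- The unnormalised thermal sum `∑_τ ∫ dθ f(θ, τ) exp (-β H_{λ,α}(θ, τ))`, where `dθ` is the
product of the uniform measures on the circle. -/
def thermalSum (G : SimpleGraph V) (J : Couplings V) (β : ℝ)
    (f : (V → Phase) → (V → ℤˣ) → ℝ) : ℝ :=
  open Classical in
  ∑ τ : V → ℤˣ, ∫ θ : V → Phase, f θ τ * Real.exp (-β * hamiltonian G J θ τ)

/-- The thermal average `⟨f⟩_{G,β}` (its denominator is the partition function). -/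
def thermalAvg (G : SimpleGraph V) (J : Couplings V) (β : ℝ)
    (f : (V → Phase) → (V → ℤˣ) → ℝ) : ℝ :=
  thermalSum G J β f / thermalSum G J β (fun _ _ => 1)

/-- `⟨τ_x τ_y⟩_{G,β}`. -/
def isingCorr (G : SimpleGraph V) (J : Couplings V) (β : ℝ) (x y : V) : ℝ :=
  thermalAvg G J β (fun _ τ => ((τ x : ℤ) : ℝ) * ((τ y : ℤ) : ℝ))

/-- `⟨cos 2(θ_x - θ_y)⟩_{G,β}`. -/
def xyCorr (G : SimpleGraph V) (J : Couplings V) (β : ℝ) (x y : V) : ℝ :=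
  thermalAvg G J β (fun θ _ => cos (2 • (θ x - θ y)))

end FiniteGraph

section Lattice

variable {V : Type*}

open Classical in
/-- `⟨τ_x τ_y⟩` in the finite subgraph induced on `Λ` (free boundary conditions);
only finite sets `Λ` that contain `x` and `y` matter below. -/
def isingCorrIn (G : SimpleGraph V) (J : Couplings V) (β : ℝ) (x y : V) (Λ : Finset V) : ℝ :=
  if h : x ∈ (Λ : Set V) ∧ y ∈ (Λ : Set V) then
    isingCorr (G.induce (Λ : Set V)) (J.restrict Λ) β ⟨x, h.1⟩ ⟨y, h.2⟩
  else 0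

open Classical in
/-- `⟨cos 2(θ_x - θ_y)⟩` in the finite subgraph induced on `Λ` (free boundary conditions);
only finite sets `Λ` that contain `x` and `y` matter below. -/
def xyCorrIn (G : SimpleGraph V) (J : Couplings V) (β : ℝ) (x y : V) (Λ : Finset V) : ℝ :=
  if h : x ∈ (Λ : Set V) ∧ y ∈ (Λ : Set V) then
    xyCorr (G.induce (Λ : Set V)) (J.restrict Λ) β ⟨x, h.1⟩ ⟨y, h.2⟩
  else 0

/-- The infinite-volume correlation `⟨τ_x τ_y⟩`: the limit along the finite subgraphs that
exhaust `G`. All terms lie in `[-1, 1]`, so that the upper limit is finite, and it is the limit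
whenever that exists (for ferromagnetic couplings the terms increase with `Λ`). -/
def isingCorrLim (G : SimpleGraph V) (J : Couplings V) (β : ℝ) (x y : V) : ℝ :=
  Filter.limsup (isingCorrIn G J β x y) Filter.atTop

/-- The infinite-volume correlation `⟨cos 2(θ_x - θ_y)⟩`, with the same conventions. -/
def xyCorrLim (G : SimpleGraph V) (J : Couplings V) (β : ℝ) (x y : V) : ℝ :=
  Filter.limsup (xyCorrIn G J β x y) Filter.atTop

/-- Exponential decay in the graph distance from the site `o`. -/
def ExpDecay (G : SimpleGraph V) (o : V) (f : V → ℝ) : Prop :=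
  ∃ C c : ℝ, 0 < c ∧ ∀ R : V, |f R| ≤ C * Real.exp (-c * (G.dist o R : ℝ))

/-- At temperature `T`, the Ising spins are disordered as seen from `o`. -/
def IsingDisordered (G : SimpleGraph V) (J : Couplings V) (o : V) (T : ℝ) : Prop :=
  ExpDecay G o (isingCorrLim G J T⁻¹ o)

/-- At temperature `T`, the XY spins are disordered as seen from `o`. -/
def XYDisordered (G : SimpleGraph V) (J : Couplings V) (o : V) (T : ℝ) : Prop :=
  ExpDecay G o (xyCorrLim G J T⁻¹ o)

/-- `T_TRSB ∈ [0, ∞]`: the least temperature above which the Ising spins are disordered. -/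
def tempTRSB (G : SimpleGraph V) (J : Couplings V) (o : V) : ℝ≥0∞ :=
  sInf {t : ℝ≥0∞ | ∀ T : ℝ, 0 < T → t < ENNReal.ofReal T → IsingDisordered G J o T}

/-- `T_c ∈ [0, ∞]`: the least temperature above which the XY spins are disordered. -/
def tempC (G : SimpleGraph V) (J : Couplings V) (o : V) : ℝ≥0∞ :=
  sInf {t : ℝ≥0∞ | ∀ T : ℝ, 0 < T → t < ENNReal.ofReal T → XYDisordered G J o T}

end Lattice

end U1Z2

end

/-! The proof is a Ginibre-type positivity argument. At each site put `X = cos θ + τ sin θ` and `Y =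
cos θ - τ sin θ`. Polynomials in all `τ_i`, `X_i`, `Y_i` with nonnegative coefficients form a
semiring, `cone`. Site by site, symmetries of the circle show that each of them has nonnegative
total integral (`sum_integral_nonneg_of_mem_cone`). The weight preserves this: `-βH` lies in the
cone (`edgeEnergy_mem_cone`, which uses `λ_e ≥ α_e`), so expanding the exponential gives a
nonnegative thermal sum for every member of the cone. Since `X² + Y² = 2` and `τ (X² - Y²) = 2 sin
2θ`, the difference `τ_x τ_y - sin 2θ_x sin 2θ_y` lies in the cone, whence `⟨sin 2θ_x sin 2θ_y⟩ ≤
⟨τ_x τ_y⟩`. By rotation invariance `⟨cos 2(θ_x - θ_y)⟩` is twice the left side. The bound survives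
upper limits, and since the XY correlation is nonnegative, Ising decay forces XY decay. -/

open MeasureTheory Filter Topology

namespace U1Z2

/-! ### Trigonometry on the circle. -/

section Trigonometry

/-- The sine, as a function on the circle `ℝ / 2πℤ`. -/
noncomputable def sin (φ : Phase) : ℝ := Real.Angle.sin φ

theorem continuous_cos : Continuous cos := Real.Angle.continuous_cos

theorem continuous_sin : Continuous sin := Real.Angle.continuous_sin

theorem sin_neg (φ : Phase) : sin (-φ) = -sin φ := Real.Angle.sin_neg φ

theorem cos_add (φ ψ : Phase) : cos (φ + ψ) = cos φ * cos ψ - sin φ * sin ψ :=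
  Real.Angle.cos_add φ ψ

theorem sin_add (φ ψ : Phase) : sin (φ + ψ) = sin φ * cos ψ + cos φ * sin ψ :=
  Real.Angle.sin_add φ ψ

theorem cos_sub (φ ψ : Phase) : cos (φ - ψ) = cos φ * cos ψ + sin φ * sin ψ := by
  rw [sub_eq_add_neg, cos_add, cos_neg, sin_neg]; ring

theorem cos_sq_add_sin_sq (φ : Phase) : cos φ ^ 2 + sin φ ^ 2 = 1 :=
  Real.Angle.cos_sq_add_sin_sq φ

theorem cos_two_nsmul (φ : Phase) : cos (2 • φ) = cos φ ^ 2 - sin φ ^ 2 := by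
  rw [two_nsmul, cos_add]; ring

theorem sin_two_nsmul (φ : Phase) : sin (2 • φ) = 2 * sin φ * cos φ := by
  rw [two_nsmul, sin_add]; ring

theorem abs_cos_le_one (φ : Phase) : |cos φ| ≤ 1 := by
  rw [abs_le_one_iff_mul_self_le_one]
  nlinarith [cos_sq_add_sin_sq φ, sq_nonneg (sin φ)]

theorem cos_add_pi (φ : Phase) : cos (φ + ((Real.pi : ℝ) : Phase)) = -cos φ :=
  Real.Angle.cos_add_pi φ

theorem sin_add_pi (φ : Phase) : sin (φ + ((Real.pi : ℝ) : Phase)) = -sin φ :=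
  Real.Angle.sin_add_pi φ

theorem cos_pi_div_two_sub (φ : Phase) : cos (((Real.pi / 2 : ℝ) : Phase) - φ) = sin φ :=
  Real.Angle.cos_pi_div_two_sub φ

theorem sin_pi_div_two_sub (φ : Phase) : sin (((Real.pi / 2 : ℝ) : Phase) - φ) = cos φ :=
  Real.Angle.sin_pi_div_two_sub φ

theorem sin_two_nsmul_add_pi_div_four (φ : Phase) :
    sin (2 • (φ + ((Real.pi / 4 : ℝ) : Phase))) = cos (2 • φ) := by
  have h : 2 • (φ + ((Real.pi / 4 : ℝ) : Phase)) = 2 • φ + ((Real.pi / 2 : ℝ) : Phase) := by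
    rw [smul_add, ← AddCircle.coe_nsmul]
    congr 2
    rw [nsmul_eq_mul]; push_cast; ring
  rw [h]
  exact Real.Angle.sin_add_pi_div_two (2 • φ)

theorem continuous_cos_two_nsmul {V : Type*} (x : V) : Continuous fun θ : V → Phase => cos (2 • θ x) :=
  continuous_cos.comp ((continuous_nsmul 2).comp (continuous_apply x))

theorem continuous_sin_two_nsmul {V : Type*} (x : V) : Continuous fun θ : V → Phase => sin (2 • θ x) :=
  continuous_sin.comp ((continuous_nsmul 2).comp (continuous_apply x))

end Trigonometry

/-! ### Positivity is stable under an exponential weight. -/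

section PositiveCone

variable {X T : Type*} [TopologicalSpace X] [CompactSpace X] [MeasurableSpace X]
  [OpensMeasurableSpace X] {μ : Measure X} [IsFiniteMeasure μ] [Fintype T]

theorem _root_.Continuous.integrable_of_compactSpace {f : X → ℝ} (hf : Continuous f) :
    Integrable f μ :=
  hf.integrable_of_hasCompactSupport (HasCompactSupport.of_compactSpace f)

/-- If all members of a semiring of functions have nonnegative integral, then so has `f * exp h`
for members `f`, `h` of the semiring. -/
theorem sum_integral_mul_exp_nonneg (P : Subsemiring (X → T → ℝ))
    (hcont : ∀ f ∈ P, ∀ t, Continuous fun x => f x t)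
    (hpos : ∀ f ∈ P, 0 ≤ ∑ t, ∫ x, f x t ∂μ) {f h : X → T → ℝ} (hf : f ∈ P) (hh : h ∈ P) :
    0 ≤ ∑ t, ∫ x, f x t * Real.exp (h x t) ∂μ := by
  have key : ∀ t, HasSum (fun n : ℕ => ∫ x, f x t * (h x t ^ n / n.factorial) ∂μ)
      (∫ x, f x t * Real.exp (h x t) ∂μ) := by
    intro t
    obtain ⟨C, hC⟩ := isCompact_univ.exists_bound_of_continuousOn (hcont f hf t).continuousOn
    obtain ⟨D, hD⟩ := isCompact_univ.exists_bound_of_continuousOn (hcont h hh t).continuousOn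
    have hCD : Summable fun n : ℕ => C * (D ^ n / n.factorial) :=
      (Real.summable_pow_div_factorial D).mul_left C
    refine hasSum_integral_of_dominated_convergence
      (fun n _ => C * (D ^ n / n.factorial)) (fun n => ?_) (fun n => ?_) ?_ ?_ ?_
    · exact (((hcont f hf t).mul (((hcont h hh t).pow n).div_const _))).aestronglyMeasurable
    · refine ae_of_all _ fun x => ?_
      have h1 := hC x trivial
      have h2 := hD x trivial
      rw [norm_mul, norm_div, norm_pow, RCLike.norm_natCast]
      have h3 : 0 ≤ C := (norm_nonneg _).trans h1
      gcongr
    · exact ae_of_all _ fun x => hCD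
    · exact integrable_const _
    · refine ae_of_all _ fun x => HasSum.mul_left _ ?_
      rw [Real.exp_eq_exp_ℝ]
      exact NormedSpace.expSeries_div_hasSum_exp (h x t)
  refine (hasSum_sum fun t (_ : t ∈ Finset.univ) => key t).nonneg fun n => ?_
  -- Each term of the exponential series is, up to the factor `1 / n!`, the integral of a member of
  -- the semiring.
  have h1 := hpos (f * h ^ n) (mul_mem hf (pow_mem hh n))
  have h2 : ∑ t, ∫ x, f x t * (h x t ^ n / n.factorial) ∂μ
      = (∑ t, ∫ x, (f * h ^ n) x t ∂μ) / n.factorial := by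
    rw [Finset.sum_div]
    refine Finset.sum_congr rfl fun t _ => ?_
    rw [← integral_div]
    refine integral_congr_ae (ae_of_all _ fun x => ?_)
    simp [mul_div_assoc]
  rw [h2]
  positivity

end PositiveCone

/-! ### Positivity at a single site. -/

section Site

/-- The value `±1` of an Ising spin, as a real number. -/
def spin (t : ℤˣ) : ℝ := ((t : ℤ) : ℝ)

theorem spin_sq (t : ℤˣ) : spin t ^ 2 = 1 := by
  rcases Int.units_eq_one_or t with rfl | rfl <;> simp [spin]

theorem abs_spin (t : ℤˣ) : |spin t| = 1 := by
  rcases Int.units_eq_one_or t with rfl | rfl <;> simp [spin]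

/-- `cos φ + τ sin φ`. -/
noncomputable def siteX (φ : Phase) (t : ℤˣ) : ℝ := cos φ + spin t * sin φ

/-- `cos φ - τ sin φ`. -/
noncomputable def siteY (φ : Phase) (t : ℤˣ) : ℝ := cos φ - spin t * sin φ

theorem continuous_siteX (t : ℤˣ) : Continuous fun φ => siteX φ t :=
  continuous_cos.add (continuous_sin.const_mul _)

theorem continuous_siteY (t : ℤˣ) : Continuous fun φ => siteY φ t :=
  continuous_cos.sub (continuous_sin.const_mul _)

theorem siteX_mul_siteY (φ : Phase) (t : ℤˣ) : siteX φ t * siteY φ t = cos (2 • φ) := by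
  rw [cos_two_nsmul, siteX, siteY]
  linear_combination (-sin φ ^ 2) * spin_sq t

theorem siteX_sq_add_siteY_sq (φ : Phase) (t : ℤˣ) : siteX φ t ^ 2 + siteY φ t ^ 2 = 2 := by
  rw [siteX, siteY]
  linear_combination 2 * sin φ ^ 2 * spin_sq t + 2 * cos_sq_add_sin_sq φ

theorem siteX_sq_sub_siteY_sq (φ : Phase) (t : ℤˣ) :
    spin t * (siteX φ t ^ 2 - siteY φ t ^ 2) = 2 * sin (2 • φ) := by
  rw [sin_two_nsmul, siteX, siteY]
  linear_combination 4 * sin φ * cos φ * spin_sq t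

/-- The monomial `τ ^ r X ^ k Y ^ l` at one site. -/
noncomputable def siteMonomial (r k l : ℕ) (φ : Phase) (t : ℤˣ) : ℝ :=
  spin t ^ r * siteX φ t ^ k * siteY φ t ^ l

theorem continuous_siteMonomial (r k l : ℕ) (t : ℤˣ) :
    Continuous fun φ => siteMonomial r k l φ t :=
  (continuous_const.mul ((continuous_siteX t).pow k)).mul ((continuous_siteY t).pow l)

/-- If both exponents are even the integrand is nonnegative. Otherwise the integral vanishes: `φ ↦ φ
+ π` flips both `X` and `Y`, which settles `k` odd and `l` even; `φ ↦ π/2 - φ` fixes `X` and flips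
`Y`, which settles `l` odd. -/
theorem integral_siteX_pow_mul_siteY_pow_nonneg (k l : ℕ) :
    0 ≤ ∫ φ : Phase, siteX φ 1 ^ k * siteY φ 1 ^ l := by
  rcases Nat.even_or_odd l with hl | hl
  · rcases Nat.even_or_odd k with hk | hk
    · exact integral_nonneg fun φ => mul_nonneg (hk.pow_nonneg _) (hl.pow_nonneg _)
    · refine le_of_eq ?_
      have h := integral_add_right_eq_self (μ := (volume : Measure Phase))
        (fun φ => siteX φ 1 ^ k * siteY φ 1 ^ l) ((Real.pi : ℝ) : Phase)
      have hX : ∀ φ : Phase, siteX (φ + ((Real.pi : ℝ) : Phase)) 1 = -siteX φ 1 := fun φ => by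
        rw [siteX, siteX, cos_add_pi, sin_add_pi]; ring
      have hY : ∀ φ : Phase, siteY (φ + ((Real.pi : ℝ) : Phase)) 1 = -siteY φ 1 := fun φ => by
        rw [siteY, siteY, cos_add_pi, sin_add_pi]; ring
      simp only [hX, hY, hk.neg_pow, hl.neg_pow, neg_mul, integral_neg] at h
      linarith
  · refine le_of_eq ?_
    have h := integral_sub_left_eq_self (μ := (volume : Measure Phase))
      (fun φ => siteX φ 1 ^ k * siteY φ 1 ^ l) ((Real.pi / 2 : ℝ) : Phase)
    have hX : ∀ φ : Phase, siteX (((Real.pi / 2 : ℝ) : Phase) - φ) 1 = siteX φ 1 := fun φ => by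
      rw [siteX, siteX, cos_pi_div_two_sub, sin_pi_div_two_sub]; simp [spin, add_comm]
    have hY : ∀ φ : Phase, siteY (((Real.pi / 2 : ℝ) : Phase) - φ) 1 = -siteY φ 1 := fun φ => by
      rw [siteY, siteY, cos_pi_div_two_sub, sin_pi_div_two_sub]; simp [spin]
    simp only [hX, hY, hl.neg_pow, mul_neg, integral_neg] at h
    linarith

/-- The reflection `φ ↦ -φ` carries `X`, `Y` at `τ = -1` to those at `τ = 1`, so the sum over `τ`
only contributes the factor `1 + (-1) ^ r`, which is `0` or `2`. -/
theorem sum_integral_siteMonomial_nonneg (r k l : ℕ) :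
    0 ≤ ∑ t : ℤˣ, ∫ φ : Phase, siteMonomial r k l φ t := by
  have hneg : ∫ φ : Phase, siteX φ (-1) ^ k * siteY φ (-1) ^ l
      = ∫ φ : Phase, siteX φ 1 ^ k * siteY φ 1 ^ l := by
    rw [← integral_neg_eq_self (fun φ : Phase => siteX φ 1 ^ k * siteY φ 1 ^ l)]
    refine integral_congr_ae (ae_of_all _ fun φ => ?_)
    simp [siteX, siteY, spin, cos_neg, sin_neg]
  have hsum : ∑ t : ℤˣ, ∫ φ : Phase, siteMonomial r k l φ t
      = (1 + (-1) ^ r) * ∫ φ : Phase, siteX φ 1 ^ k * siteY φ 1 ^ l := by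
    have h : ∀ t : ℤˣ, ∫ φ : Phase, siteMonomial r k l φ t
        = spin t ^ r * ∫ φ : Phase, siteX φ t ^ k * siteY φ t ^ l := fun t => by
      rw [← integral_const_mul]
      simp only [siteMonomial, mul_assoc]
    simp only [h]
    rw [Fintype.sum_eq_add (1 : ℤˣ) (-1) (by decide) (fun t ht => by
      rcases Int.units_eq_one_or t with rfl | rfl <;> simp at ht), hneg]
    simp [spin, add_mul]
  rw [hsum]
  refine mul_nonneg ?_ (integral_siteX_pow_mul_siteY_pow_nonneg k l)
  rcases neg_one_pow_eq_or ℝ r with h | h <;> rw [h] <;> norm_num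

end Site

/-! ### The cone of configurations and the inequality on a finite graph. -/

section Configurations

variable {V : Type*} [Fintype V]

/-- The functions `c ∏ τ_i ^ r_i X_i ^ k_i Y_i ^ l_i` of the configuration, with `c ≥ 0`. -/
def monomials (V : Type*) [Fintype V] : Submonoid ((V → Phase) → (V → ℤˣ) → ℝ) where
  carrier := {F | ∃ (c : ℝ) (r k l : V → ℕ), 0 ≤ c ∧
    F = fun θ τ => c * ∏ i, siteMonomial (r i) (k i) (l i) (θ i) (τ i)}
  one_mem' := ⟨1, 0, 0, 0, zero_le_one, by ext; simp [siteMonomial]⟩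
  mul_mem' := by
    rintro _ _ ⟨c, r, k, l, hc, rfl⟩ ⟨c', r', k', l', hc', rfl⟩
    refine ⟨c * c', r + r', k + k', l + l', mul_nonneg hc hc', ?_⟩
    ext θ τ
    simp only [Pi.mul_apply, Pi.add_apply]
    rw [mul_mul_mul_comm, ← Finset.prod_mul_distrib]
    refine congrArg _ (Finset.prod_congr rfl fun i _ => ?_)
    simp only [siteMonomial, pow_add]
    ring

/-- The cone spanned by the monomials in `τ_i`, `X_i`, `Y_i`. -/
def cone (V : Type*) [Fintype V] : Subsemiring ((V → Phase) → (V → ℤˣ) → ℝ) :=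
  (monomials V).subsemiringClosure

/-- The monomials are already closed under products, so inductions over the cone only have to treat
monomials and sums. -/
theorem mem_cone_iff {F : (V → Phase) → (V → ℤˣ) → ℝ} :
    F ∈ cone V ↔ F ∈ AddSubmonoid.closure (monomials V : Set ((V → Phase) → (V → ℤˣ) → ℝ)) :=
  Submonoid.subsemiringClosure_mem _

theorem mem_cone_of_mem_monomials {F : (V → Phase) → (V → ℤˣ) → ℝ} (hF : F ∈ monomials V) :
    F ∈ cone V :=
  mem_cone_iff.2 (AddSubmonoid.subset_closure hF)

theorem continuous_of_mem_cone {F : (V → Phase) → (V → ℤˣ) → ℝ} (hF : F ∈ cone V) (τ : V → ℤˣ) :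
    Continuous fun θ => F θ τ := by
  rw [mem_cone_iff] at hF
  induction hF using AddSubmonoid.closure_induction with
  | mem F hF =>
    obtain ⟨c, r, k, l, -, rfl⟩ := hF
    exact continuous_const.mul (continuous_finsetProd _ fun i _ =>
      (continuous_siteMonomial _ _ _ _).comp (continuous_apply i))
  | zero => exact continuous_const
  | add F F' h h' ihF ihF' =>
    exact ihF.add ihF'

open Classical in
theorem sum_integral_nonneg_of_mem_cone {F : (V → Phase) → (V → ℤˣ) → ℝ} (hF : F ∈ cone V) :
    0 ≤ ∑ τ : V → ℤˣ, ∫ θ, F θ τ := by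
  rw [mem_cone_iff] at hF
  induction hF using AddSubmonoid.closure_induction with
  | mem F hF =>
    obtain ⟨c, r, k, l, hc, rfl⟩ := hF
    have h : ∀ τ : V → ℤˣ,
        ∫ θ : V → Phase, c * ∏ i, siteMonomial (r i) (k i) (l i) (θ i) (τ i)
          = c * ∏ i, ∫ φ : Phase, siteMonomial (r i) (k i) (l i) φ (τ i) := fun τ => by
      rw [integral_const_mul]
      exact congrArg _ (integral_fintype_prod_volume_eq_prod
        fun i φ => siteMonomial (r i) (k i) (l i) φ (τ i))
    simp only [h]
    -- The sum over configurations of a product over sites factors into a product of one-site sums.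
    rw [← Finset.mul_sum,
      ← Fintype.prod_sum fun i t => ∫ φ : Phase, siteMonomial (r i) (k i) (l i) φ t]
    exact mul_nonneg hc (Finset.prod_nonneg fun i _ => sum_integral_siteMonomial_nonneg _ _ _)
  | zero => simp
  | add F F' h h' ihF ihF' =>
    have h := mem_cone_iff.2 h
    have h' := mem_cone_iff.2 h'
    have hadd : ∀ τ : V → ℤˣ, ∫ θ, (F + F') θ τ = (∫ θ, F θ τ) + ∫ θ, F' θ τ := fun τ =>
      integral_add (continuous_of_mem_cone h τ).integrable_of_compactSpace
        (continuous_of_mem_cone h' τ).integrable_of_compactSpace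
    simp only [hadd, Finset.sum_add_distrib]
    exact add_nonneg ihF ihF'

theorem const_mem_cone {c : ℝ} (hc : 0 ≤ c) :
    (fun _ _ => c : (V → Phase) → (V → ℤˣ) → ℝ) ∈ cone V :=
  mem_cone_of_mem_monomials ⟨c, 0, 0, 0, hc, by ext; simp [siteMonomial]⟩

open Classical in
theorem spin_mem_cone (i : V) : (fun _ τ => spin (τ i) : (V → Phase) → (V → ℤˣ) → ℝ) ∈ cone V := by
  refine mem_cone_of_mem_monomials ⟨1, Pi.single i 1, 0, 0, zero_le_one, ?_⟩
  ext θ τ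
  rw [Fintype.prod_eq_single i (fun j hj => by simp [siteMonomial, hj])]
  simp [siteMonomial]

open Classical in
theorem siteX_mem_cone (i : V) :
    (fun θ τ => siteX (θ i) (τ i) : (V → Phase) → (V → ℤˣ) → ℝ) ∈ cone V := by
  refine mem_cone_of_mem_monomials ⟨1, 0, Pi.single i 1, 0, zero_le_one, ?_⟩
  ext θ τ
  rw [Fintype.prod_eq_single i (fun j hj => by simp [siteMonomial, hj])]
  simp [siteMonomial]

open Classical in
theorem siteY_mem_cone (i : V) :
    (fun θ τ => siteY (θ i) (τ i) : (V → Phase) → (V → ℤˣ) → ℝ) ∈ cone V := by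
  refine mem_cone_of_mem_monomials ⟨1, 0, 0, Pi.single i 1, zero_le_one, ?_⟩
  ext θ τ
  rw [Fintype.prod_eq_single i (fun j hj => by simp [siteMonomial, hj])]
  simp [siteMonomial]

theorem spin_mul_spin_mem_cone (i j : V) :
    (fun _ τ => spin (τ i) * spin (τ j) : (V → Phase) → (V → ℤˣ) → ℝ) ∈ cone V :=
  mul_mem (spin_mem_cone i) (spin_mem_cone j)

theorem cos_two_mul_cos_two_mem_cone (i j : V) :
    (fun θ _ => cos (2 • θ i) * cos (2 • θ j) : (V → Phase) → (V → ℤˣ) → ℝ) ∈ cone V := by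
  convert mul_mem (mul_mem (siteX_mem_cone i) (siteY_mem_cone i))
    (mul_mem (siteX_mem_cone j) (siteY_mem_cone j)) using 1
  ext θ τ
  simp only [Pi.mul_apply, siteX_mul_siteY]

/-- Write `4 = (X_i² + Y_i²)(X_j² + Y_j²)` and `4 sin 2θ_i sin 2θ_j = τ_i τ_j (X_i² - Y_i²)(X_j² -
Y_j²)`. In the difference the negative terms cancel, leaving `τ_i τ_j (X_i² Y_j² + Y_i² X_j²) / 2`.
-/
theorem spin_sub_sin_two_mem_cone (i j : V) :
    (fun θ τ => spin (τ i) * spin (τ j) - sin (2 • θ i) * sin (2 • θ j) :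
      (V → Phase) → (V → ℤˣ) → ℝ) ∈ cone V := by
  convert mul_mem (const_mem_cone (V := V) (c := 1 / 2) (by norm_num))
    (mul_mem (spin_mul_spin_mem_cone i j)
      (add_mem (mul_mem (pow_mem (siteX_mem_cone i) 2) (pow_mem (siteY_mem_cone j) 2))
        (mul_mem (pow_mem (siteY_mem_cone i) 2) (pow_mem (siteX_mem_cone j) 2)))) using 1
  ext θ τ
  simp only [Pi.mul_apply, Pi.add_apply, Pi.pow_apply]
  have h1 := siteX_sq_add_siteY_sq (θ i) (τ i)
  have h2 := siteX_sq_add_siteY_sq (θ j) (τ j)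
  have h3 := siteX_sq_sub_siteY_sq (θ i) (τ i)
  have h4 := siteX_sq_sub_siteY_sq (θ j) (τ j)
  have h5 : 4 * (sin (2 • θ i) * sin (2 • θ j)) =
      (spin (τ i) * (siteX (θ i) (τ i) ^ 2 - siteY (θ i) (τ i) ^ 2)) *
      (spin (τ j) * (siteX (θ j) (τ j) ^ 2 - siteY (θ j) (τ j) ^ 2)) := by rw [h3, h4]; ring
  have h6 : spin (τ i) * spin (τ j) * 4 = spin (τ i) * spin (τ j) *
      ((siteX (θ i) (τ i) ^ 2 + siteY (θ i) (τ i) ^ 2) *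
        (siteX (θ j) (τ j) ^ 2 + siteY (θ j) (τ j) ^ 2)) := by rw [h1, h2]; ring
  linear_combination (1 / 4) * h6 - (1 / 4) * h5

theorem spin_add_sin_two_mem_cone (i j : V) :
    (fun θ τ => spin (τ i) * spin (τ j) + sin (2 • θ i) * sin (2 • θ j) :
      (V → Phase) → (V → ℤˣ) → ℝ) ∈ cone V := by
  convert mul_mem (const_mem_cone (V := V) (c := 1 / 2) (by norm_num))
    (mul_mem (spin_mul_spin_mem_cone i j)
      (add_mem (mul_mem (pow_mem (siteX_mem_cone i) 2) (pow_mem (siteX_mem_cone j) 2))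
        (mul_mem (pow_mem (siteY_mem_cone i) 2) (pow_mem (siteY_mem_cone j) 2)))) using 1
  ext θ τ
  simp only [Pi.mul_apply, Pi.add_apply, Pi.pow_apply]
  have h1 := siteX_sq_add_siteY_sq (θ i) (τ i)
  have h2 := siteX_sq_add_siteY_sq (θ j) (τ j)
  have h3 := siteX_sq_sub_siteY_sq (θ i) (τ i)
  have h4 := siteX_sq_sub_siteY_sq (θ j) (τ j)
  have h5 : 4 * (sin (2 • θ i) * sin (2 • θ j)) =
      (spin (τ i) * (siteX (θ i) (τ i) ^ 2 - siteY (θ i) (τ i) ^ 2)) *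
      (spin (τ j) * (siteX (θ j) (τ j) ^ 2 - siteY (θ j) (τ j) ^ 2)) := by rw [h3, h4]; ring
  have h6 : spin (τ i) * spin (τ j) * 4 = spin (τ i) * spin (τ j) *
      ((siteX (θ i) (τ i) ^ 2 + siteY (θ i) (τ i) ^ 2) *
        (siteX (θ j) (τ j) ^ 2 + siteY (θ j) (τ j) ^ 2)) := by rw [h1, h2]; ring
  linear_combination (1 / 4) * h6 + (1 / 4) * h5

/-- Here `X_i X_j + Y_i Y_j = 2 (cos θ_i cos θ_j + τ_i τ_j sin θ_i sin θ_j)`, and the factor `1 +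
τ_i τ_j` absorbs the sign `τ_i τ_j`. -/
theorem one_add_spin_mul_cos_mem_cone (i j : V) :
    (fun θ τ => (1 + spin (τ i) * spin (τ j)) * cos (θ i - θ j) :
      (V → Phase) → (V → ℤˣ) → ℝ) ∈ cone V := by
  convert mul_mem (const_mem_cone (V := V) (c := 1 / 2) (by norm_num))
    (mul_mem (add_mem (one_mem _) (spin_mul_spin_mem_cone i j))
      (add_mem (mul_mem (siteX_mem_cone i) (siteX_mem_cone j))
        (mul_mem (siteY_mem_cone i) (siteY_mem_cone j)))) using 1
  ext θ τ
  simp only [Pi.mul_apply, Pi.add_apply, Pi.one_apply, siteX, siteY, cos_sub]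
  rcases Int.units_eq_one_or (τ i) with hi | hi <;>
    rcases Int.units_eq_one_or (τ j) with hj | hj <;> rw [hi, hj] <;> simp [spin] <;> ring

/-- The term `α sin 2θ_i sin 2θ_j` has negative coefficients in `X`, `Y`; a share `α` of the Ising
coupling compensates them, and the rest `lam - α` must be nonnegative. -/
theorem edgeEnergy_mem_cone {κ lam α : ℝ} (hκ : 0 ≤ κ) (hα : 0 ≤ α) (hlam : α ≤ lam) (i j : V) :
    (fun θ τ => κ * ((1 + spin (τ i) * spin (τ j)) * cos (θ i - θ j))
      + (lam * (spin (τ i) * spin (τ j)) + α * cos (2 • (θ i - θ j))) :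
      (V → Phase) → (V → ℤˣ) → ℝ) ∈ cone V := by
  convert add_mem (mul_mem (const_mem_cone hκ) (one_add_spin_mul_cos_mem_cone i j))
    (add_mem (mul_mem (const_mem_cone (sub_nonneg.2 hlam)) (spin_mul_spin_mem_cone i j))
      (mul_mem (const_mem_cone hα)
        (add_mem (spin_add_sin_two_mem_cone i j) (cos_two_mul_cos_two_mem_cone i j)))) using 1
  ext θ τ
  simp only [Pi.mul_apply, Pi.add_apply, smul_sub, cos_sub (2 • θ i)]
  ring

/-- Conditions on the couplings under which `-H_{λ,α}` lies in the cone. -/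
structure Couplings.Admissible {V : Type*} (J : Couplings V) (G : SimpleGraph V) : Prop where
  kap_nonneg : ∀ e ∈ G.edgeSet, 0 ≤ J.kap e
  alp_nonneg : ∀ e ∈ G.edgeSet, 0 ≤ J.alp e
  alp_le_lam : ∀ e ∈ G.edgeSet, J.alp e ≤ J.lam e

theorem Couplings.Admissible.restrict {V : Type*} {J : Couplings V} {G : SimpleGraph V}
    (hJ : J.Admissible G) (S : Set V) : (J.restrict S).Admissible (G.induce S) := by
  have h : ∀ e ∈ (G.induce S).edgeSet, e.map Subtype.val ∈ G.edgeSet := by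
    intro e he
    induction e with
    | _ i j => simpa using he
  exact ⟨fun e he => hJ.1 _ (h e he), fun e he => hJ.2 _ (h e he), fun e he => hJ.3 _ (h e he)⟩

variable {G : SimpleGraph V} {J : Couplings V} {β : ℝ}

theorem neg_mul_hamiltonian_mem_cone (hJ : J.Admissible G) (hβ : 0 ≤ β) :
    (fun θ τ => -β * hamiltonian G J θ τ : (V → Phase) → (V → ℤˣ) → ℝ) ∈ cone V := by
  classical
  have h : (fun θ τ => -β * hamiltonian G J θ τ : (V → Phase) → (V → ℤˣ) → ℝ)
      = (fun _ _ => β) * ∑ e ∈ G.edgeFinset, fun θ τ =>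
        J.kap e * (1 + isingBond τ e) * xyBond 1 θ e
          + (J.lam e * isingBond τ e + J.alp e * xyBond 2 θ e) := by
    ext θ τ
    simp only [hamiltonian, criticalHamiltonian, Pi.mul_apply, Finset.sum_apply,
      Finset.sum_add_distrib]
    ring_nf
  rw [h]
  refine mul_mem (const_mem_cone hβ) (sum_mem fun e he => ?_)
  rw [SimpleGraph.mem_edgeFinset] at he
  induction e with
  | _ i j =>
    convert edgeEnergy_mem_cone (hJ.1 _ he) (hJ.2 _ he) (hJ.3 _ he) i j using 4
    · simp [isingBond, xyBond, spin, mul_assoc]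
    · simp [isingBond, xyBond, spin]

theorem continuous_exp_hamiltonian (hJ : J.Admissible G) (hβ : 0 ≤ β) (τ : V → ℤˣ) :
    Continuous fun θ => Real.exp (-β * hamiltonian G J θ τ) :=
  Real.continuous_exp.comp (continuous_of_mem_cone (neg_mul_hamiltonian_mem_cone hJ hβ) τ)

theorem thermalSum_nonneg_of_mem_cone (hJ : J.Admissible G) (hβ : 0 ≤ β)
    {f : (V → Phase) → (V → ℤˣ) → ℝ} (hf : f ∈ cone V) : 0 ≤ thermalSum G J β f := by
  classical
  have h := sum_integral_mul_exp_nonneg (μ := volume) (cone V)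
    (fun f hf => continuous_of_mem_cone hf)
    (fun f hf => by convert sum_integral_nonneg_of_mem_cone hf) hf
    (neg_mul_hamiltonian_mem_cone hJ hβ)
  unfold thermalSum
  convert h

theorem thermalSum_add (hJ : J.Admissible G) (hβ : 0 ≤ β) {f g : (V → Phase) → (V → ℤˣ) → ℝ}
    (hf : ∀ τ, Continuous fun θ => f θ τ) (hg : ∀ τ, Continuous fun θ => g θ τ) :
    thermalSum G J β (fun θ τ => f θ τ + g θ τ) = thermalSum G J β f + thermalSum G J β g := by
  unfold thermalSum
  rw [← Finset.sum_add_distrib]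
  refine Finset.sum_congr rfl fun τ _ => ?_
  simp only [add_mul]
  exact integral_add ((hf τ).mul (continuous_exp_hamiltonian hJ hβ τ)).integrable_of_compactSpace
    ((hg τ).mul (continuous_exp_hamiltonian hJ hβ τ)).integrable_of_compactSpace

theorem thermalSum_nonneg {f : (V → Phase) → (V → ℤˣ) → ℝ} (hf : ∀ θ τ, 0 ≤ f θ τ) :
    0 ≤ thermalSum G J β f :=
  Finset.sum_nonneg fun τ _ => integral_nonneg fun θ => mul_nonneg (hf θ τ) (Real.exp_pos _).le

theorem abs_thermalAvg_le_one (hJ : J.Admissible G) (hβ : 0 ≤ β)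
    {f : (V → Phase) → (V → ℤˣ) → ℝ} (hf : ∀ θ τ, |f θ τ| ≤ 1) : |thermalAvg G J β f| ≤ 1 := by
  have h1 : 0 ≤ thermalSum G J β fun _ _ => 1 := thermalSum_nonneg fun _ _ => zero_le_one
  rw [thermalAvg, abs_div, abs_of_nonneg h1]
  -- Because `x / 0 = 0`, a nonnegative partition function suffices here.
  refine div_le_one_of_le₀ ?_ h1
  refine (Finset.abs_sum_le_sum_abs _ _).trans (Finset.sum_le_sum fun τ _ => ?_)
  rw [← Real.norm_eq_abs]
  refine norm_integral_le_of_norm_le (μ := (volume : Measure (V → Phase)))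
    (continuous_const.mul (continuous_exp_hamiltonian hJ hβ τ)).integrable_of_compactSpace
    (ae_of_all _ fun θ => ?_)
  rw [norm_mul, Real.norm_of_nonneg (Real.exp_pos _).le]
  exact mul_le_mul_of_nonneg_right (hf θ τ) (Real.exp_pos _).le

theorem hamiltonian_add_const (θ : V → Phase) (τ : V → ℤˣ) (a : Phase) :
    hamiltonian G J (θ + fun _ => a) τ = hamiltonian G J θ τ := by
  have h : ∀ m e, xyBond m (θ + fun _ => a) e = xyBond m θ e := by
    intro m e
    induction e with
    | _ i j => simp [xyBond]
  simp only [hamiltonian, criticalHamiltonian, h]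

/-- Rotation invariance turns `sin 2θ_x sin 2θ_y` into `cos 2θ_x cos 2θ_y`. -/
theorem thermalSum_sin_two_mul_sin_two (x y : V) :
    thermalSum G J β (fun θ _ => sin (2 • θ x) * sin (2 • θ y))
      = thermalSum G J β (fun θ _ => cos (2 • θ x) * cos (2 • θ y)) := by
  refine Finset.sum_congr rfl fun τ _ => ?_
  rw [← integral_add_right_eq_self (μ := (volume : Measure (V → Phase))) _
    (fun _ => ((Real.pi / 4 : ℝ) : Phase))]
  simp only [hamiltonian_add_const, Pi.add_apply, sin_two_nsmul_add_pi_div_four]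

theorem thermalSum_cos_two_sub (hJ : J.Admissible G) (hβ : 0 ≤ β) (x y : V) :
    thermalSum G J β (fun θ _ => cos (2 • (θ x - θ y)))
      = thermalSum G J β (fun θ _ => cos (2 • θ x) * cos (2 • θ y))
        + thermalSum G J β (fun θ _ => sin (2 • θ x) * sin (2 • θ y)) := by
  simp only [smul_sub, cos_sub (2 • _)]
  exact thermalSum_add hJ hβ
    (fun _ => (continuous_cos_two_nsmul x).mul (continuous_cos_two_nsmul y))
    (fun _ => (continuous_sin_two_nsmul x).mul (continuous_sin_two_nsmul y))

/-- This lower bound lets the one-sided inequality control the absolute value in `XYDisordered`, and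
makes the real-valued `limsup` well behaved. -/
theorem xyCorr_nonneg (hJ : J.Admissible G) (hβ : 0 ≤ β) (x y : V) : 0 ≤ xyCorr G J β x y := by
  refine div_nonneg ?_ (thermalSum_nonneg fun _ _ => zero_le_one)
  rw [thermalSum_cos_two_sub hJ hβ, thermalSum_sin_two_mul_sin_two]
  have h := thermalSum_nonneg_of_mem_cone hJ hβ (cos_two_mul_cos_two_mem_cone x y)
  exact add_nonneg h h

theorem xyCorr_le_two_mul_isingCorr (hJ : J.Admissible G) (hβ : 0 ≤ β) (x y : V) :
    xyCorr G J β x y ≤ 2 * isingCorr G J β x y := by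
  rw [xyCorr, isingCorr, thermalAvg, thermalAvg, ← mul_div_assoc]
  refine div_le_div_of_nonneg_right ?_ (thermalSum_nonneg fun _ _ => zero_le_one)
  rw [thermalSum_cos_two_sub hJ hβ, ← thermalSum_sin_two_mul_sin_two]
  have hdiff := spin_sub_sin_two_mem_cone x y
  have h := thermalSum_nonneg_of_mem_cone hJ hβ hdiff
  -- Adding `sin 2θ_x sin 2θ_y` back to the cone element recovers `τ_x τ_y`.
  have hadd := thermalSum_add hJ hβ (continuous_of_mem_cone hdiff)
    (g := fun θ _ => sin (2 • θ x) * sin (2 • θ y))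
    (fun _ => (continuous_sin_two_nsmul x).mul (continuous_sin_two_nsmul y))
  simp only [sub_add_cancel] at hadd
  simp only [spin] at hadd h
  linarith

theorem abs_isingCorr_le_one (hJ : J.Admissible G) (hβ : 0 ≤ β) (x y : V) :
    |isingCorr G J β x y| ≤ 1 :=
  abs_thermalAvg_le_one hJ hβ fun _ τ => by
    rw [abs_mul]
    exact (congrArg₂ (· * ·) (abs_spin (τ x)) (abs_spin (τ y))).le.trans_eq (one_mul 1)

theorem abs_xyCorr_le_one (hJ : J.Admissible G) (hβ : 0 ≤ β) (x y : V) :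
    |xyCorr G J β x y| ≤ 1 :=
  abs_thermalAvg_le_one hJ hβ fun _ _ => abs_cos_le_one _

end Configurations

/-! ### Infinite volume, exponential decay and critical temperatures. -/

section InfiniteVolume

variable {V : Type*} {G : SimpleGraph V} {J : Couplings V} {β : ℝ}

theorem xyCorrIn_nonneg (hJ : J.Admissible G) (hβ : 0 ≤ β) (x y : V) (Λ : Finset V) :
    0 ≤ xyCorrIn G J β x y Λ := by
  unfold xyCorrIn
  split_ifs
  · exact xyCorr_nonneg (hJ.restrict _) hβ _ _
  · exact le_rfl

theorem xyCorrIn_le_one (hJ : J.Admissible G) (hβ : 0 ≤ β) (x y : V) (Λ : Finset V) :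
    xyCorrIn G J β x y Λ ≤ 1 := by
  unfold xyCorrIn
  split_ifs
  · exact (abs_le.1 (abs_xyCorr_le_one (hJ.restrict _) hβ _ _)).2
  · exact zero_le_one

theorem isingCorrIn_le_one (hJ : J.Admissible G) (hβ : 0 ≤ β) (x y : V) (Λ : Finset V) :
    isingCorrIn G J β x y Λ ≤ 1 := by
  unfold isingCorrIn
  split_ifs
  · exact (abs_le.1 (abs_isingCorr_le_one (hJ.restrict _) hβ _ _)).2
  · exact zero_le_one

theorem xyCorrIn_le_two_mul_isingCorrIn (hJ : J.Admissible G) (hβ : 0 ≤ β) (x y : V)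
    (Λ : Finset V) : xyCorrIn G J β x y Λ ≤ 2 * isingCorrIn G J β x y Λ := by
  unfold xyCorrIn isingCorrIn
  split_ifs
  · exact xyCorr_le_two_mul_isingCorr (hJ.restrict _) hβ _ _
  · simp

theorem xyCorrLim_nonneg (hJ : J.Admissible G) (hβ : 0 ≤ β) (x y : V) :
    0 ≤ xyCorrLim G J β x y := by
  classical
  refine le_limsup_of_le (isBoundedUnder_of ⟨1, xyCorrIn_le_one hJ hβ x y⟩) fun b hb => ?_
  obtain ⟨Λ, hΛ⟩ := hb.exists
  exact (xyCorrIn_nonneg hJ hβ x y Λ).trans hΛ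

theorem xyCorrLim_le_two_mul_isingCorrLim (hJ : J.Admissible G) (hβ : 0 ≤ β) (x y : V) :
    xyCorrLim G J β x y ≤ 2 * isingCorrLim G J β x y := by
  classical
  have hbdd : IsBoundedUnder (· ≤ ·) atTop (isingCorrIn G J β x y) :=
    isBoundedUnder_of ⟨1, isingCorrIn_le_one hJ hβ x y⟩
  have hcobdd : IsCoboundedUnder (· ≤ ·) atTop (xyCorrIn G J β x y) :=
    (isBoundedUnder_of ⟨0, xyCorrIn_nonneg hJ hβ x y⟩ :
      IsBoundedUnder (· ≥ ·) atTop (xyCorrIn G J β x y)).isCoboundedUnder_le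
  refine le_of_forall_pos_le_add fun ε hε => ?_
  refine limsup_le_of_le hcobdd ?_
  -- The margin is `ε / 2` because the inequality doubles it.
  filter_upwards [eventually_lt_of_limsup_lt
    (show limsup (isingCorrIn G J β x y) atTop < isingCorrLim G J β x y + ε / 2 from
      lt_add_of_pos_right _ (half_pos hε)) hbdd] with Λ hΛ
  linarith [xyCorrIn_le_two_mul_isingCorrIn hJ hβ x y Λ]

theorem IsingDisordered.xyDisordered (hJ : J.Admissible G) {o : V} {T : ℝ} (hT : 0 < T)
    (h : IsingDisordered G J o T) : XYDisordered G J o T := by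
  obtain ⟨C, c, hc, hdecay⟩ := h
  refine ⟨2 * C, c, hc, fun R => ?_⟩
  have hβ : 0 ≤ T⁻¹ := (inv_pos.2 hT).le
  rw [abs_of_nonneg (xyCorrLim_nonneg hJ hβ o R)]
  linarith [xyCorrLim_le_two_mul_isingCorrLim hJ hβ o R, hdecay R,
    le_abs_self (isingCorrLim G J T⁻¹ o R)]

/-- Every threshold admitted for the Ising spins is admitted for the XY spins, so the infimum runs
over a larger set. -/
theorem tempC_le_tempTRSB (hJ : J.Admissible G) (o : V) : tempC G J o ≤ tempTRSB G J o :=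
  sInf_le_sInf fun _ ht T hT htT => (ht T hT htT).xyDisordered hJ hT

end InfiniteVolume

end U1Z2

theorem mainTheorem1 {V : Type*} (G : SimpleGraph V) (J : U1Z2.Couplings V)
    (hkap : ∀ e ∈ G.edgeSet, 0 ≤ J.kap e)
    (halp : ∀ e ∈ G.edgeSet, 0 ≤ J.alp e)
    (hlam : ∀ e ∈ G.edgeSet, J.alp e ≤ J.lam e)
    (hratio : ∀ e ∈ G.edgeSet, J.alp e ≤ J.kap e / 2) :
    -- the correlation inequality on a finite graph
    (∀ [Fintype V] (β : ℝ), 0 ≤ β → ∀ o R : V,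
      U1Z2.xyCorr G J β o R ≤ 2 * U1Z2.isingCorr G J β o R) ∧
    -- its consequences on an arbitrary, possibly infinite, graph
    (∀ β : ℝ, 0 ≤ β → ∀ o R : V,
      U1Z2.xyCorrLim G J β o R ≤ 2 * U1Z2.isingCorrLim G J β o R) ∧
    (∀ (o : V) (T : ℝ), 0 < T →
      U1Z2.IsingDisordered G J o T → U1Z2.XYDisordered G J o T) ∧
    (∀ o : V, U1Z2.tempC G J o ≤ U1Z2.tempTRSB G J o) := by
  have hJ : J.Admissible G := ⟨hkap, halp, hlam⟩
  exact ⟨fun β hβ o R => U1Z2.xyCorr_le_two_mul_isingCorr hJ hβ o R,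
    fun β hβ o R => U1Z2.xyCorrLim_le_two_mul_isingCorrLim hJ hβ o R,
    fun o T hT h => U1Z2.IsingDisordered.xyDisordered hJ hT h,
    fun o => U1Z2.tempC_le_tempTRSB hJ o⟩
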